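/- Let $n\ge 1$, $m\ge 0$, $k\in\{2,3,\dots\}\cup\{\infty\}$, and let $\mathcal X\subset\mathbb R^n$ be open. A scalar neural ODE $\Phi\in\mathrm{NODE}^k(\mathcal X,\mathbb R)$ is a map $$\Phi:\mathcal X\to\mathbb R,\qquad \Phi(x)=\widetilde W\,h_{Wx+b}(T)+\tilde b,$$ with $W\in\mathbb R^{m\times n}$, $b\in\mathbb R^m$, $\widetilde W\in\mathbb R^{1\times m}$, $\tilde b\in\mathbb R$, $T\ge 0$, where $h_a$ denotes the solution, on its maximal open time interval of existence $\mathcal I_a\subset\Omega_t$, of the initial value problem $h'(t)=f(t,h(t))$, $h(0)=a$. Here $\Omega_t\subset\mathbb R$ and $\Omega_h\subset\mathbb R^m$ are open; $f\in C^{0,k}(\Omega_t\times\Omega_h,\mathbb R^m)$, i.e. $f$ and all its partial derivatives of order at most $k$ with respect to the second variable exist and are continuous on $\Omega_t\times\Omega_h$; and for every $x\in\mathcal X$ the initial value $a=Wx+b$ satisfies $a\in\Omega_h$ and $[0,T]\subset\mathcal I_a$. Put $\eta(a):=\widetilde W\,h_a(T)$ for all $a\in\Omega_h$ with $[0,T]\subset\mathcal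 I_a$. Then for every $x\in\mathcal X$ the map $\eta$ is $C^k$ at $Wx+b$, and the Hessian matrices satisfy $$H_\Phi(x)=W^\top H_\eta(Wx+b)\,W .$$ Call $\Phi$ degenerate if at least one of its two weight matrices does not have full rank, i.e. $\operatorname{rank}(W)<\min\{m,n\}$ or $\operatorname{rank}(\widetilde W)=0$. If $\Phi$ is degenerate, then $\operatorname{rank}(W)<\min\{m,n\}$ or $\widetilde W=0$, and every critical point of $\Phi$ is degenerate: if $p\in\mathcal X$ and $\nabla\Phi(p)=0$, then $H_\Phi(p)$ is singular. Consequently $\Phi$ belongs to $(\mathcal C1)^k(\mathcal X,\mathbb R)$ or to $(\mathcal C3)^k(\mathcal X,\mathbb R)$, where $(\mathcal C1)^k(\mathcal X,\mathbb R)$ is the set of $\Psi\in C^k(\mathcal X,\mathbb R)$ with $\nabla\Psi(x)\ne0$ for all $x\in\mathcal X$, and $(\mathcal C3)^k(\mathcal X,\mathbb R)$ is the set of $\Psi\in C^k(\mathcal X,\mathbb R)$ for which there is $p\in\mathcal X$ with $\nabla\Psi(p)=0$ and $H_\Psi(p)$ singular. -/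

import Mathlib

namespace ScalarNODE

/-- `Φ` is of class `C^k` on `X` and has no critical point in `X` (the class `(𝒞1)^k(X, ℝ)`). -/
def ClassC1 {n : ℕ} (k : ℕ∞) (X : Set (EuclideanSpace ℝ (Fin n))) :
    Set (EuclideanSpace ℝ (Fin n) → ℝ) :=
  {Φ | ContDiffOn ℝ k Φ X ∧ ∀ x ∈ X, gradient Φ x ≠ 0}

/-- The Hessian matrix of second partial derivatives of `Φ` at `x`. -/
noncomputable def hessian {n : ℕ} (Φ : EuclideanSpace ℝ (Fin n) → ℝ)
    (x : EuclideanSpace ℝ (Fin n)) : Matrix (Fin n) (Fin n) ℝ :=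
  Matrix.of fun i j =>
    fderiv ℝ (fun y => fderiv ℝ Φ y (EuclideanSpace.single j 1)) x (EuclideanSpace.single i 1)

/-- A point with zero gradient. -/
def IsCriticalPoint {n : ℕ} (Φ : EuclideanSpace ℝ (Fin n) → ℝ)
    (p : EuclideanSpace ℝ (Fin n)) : Prop :=
  gradient Φ p = 0

/-- A critical point whose Hessian matrix is singular. -/
def IsDegenerateCriticalPoint {n : ℕ} (Φ : EuclideanSpace ℝ (Fin n) → ℝ)
    (p : EuclideanSpace ℝ (Fin n)) : Prop :=
  IsCriticalPoint Φ p ∧ (hessian Φ p).det = 0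

/-- `Φ` is of class `C^k` on `X` and has at least one degenerate critical point in `X`
(the class `(𝒞3)^k(X, ℝ)`, considered for `k ≥ 2`). -/
def ClassC3 {n : ℕ} (k : ℕ∞) (X : Set (EuclideanSpace ℝ (Fin n))) :
    Set (EuclideanSpace ℝ (Fin n) → ℝ) :=
  {Φ | ContDiffOn ℝ k Φ X ∧ ∃ p ∈ X, IsDegenerateCriticalPoint Φ p}

/-- The class `C^{0,k}(Ωt × Ωh, ℝ^m)` for open `Ωt`, `Ωh`: `f` is `k` times differentiable in its
second variable, and `f` and all these derivatives are continuous on `Ωt × Ωh`. -/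
def IsC0k {m : ℕ} (k : ℕ∞)
    (f : ℝ → EuclideanSpace ℝ (Fin m) → EuclideanSpace ℝ (Fin m))
    (Ωt : Set ℝ) (Ωh : Set (EuclideanSpace ℝ (Fin m))) : Prop :=
  (∀ t ∈ Ωt, ContDiffOn ℝ k (f t) Ωh) ∧
    ∀ j : ℕ, (j : ℕ∞) ≤ k →
      ContinuousOn
        (fun p : ℝ × EuclideanSpace ℝ (Fin m) => iteratedFDeriv ℝ j (f p.1) p.2) (Ωt ×ˢ Ωh)

/-- `h` solves `h' = f(t, h)`, `h 0 = a` on the open interval `J ∋ 0`, with graph in `Ωt × Ωh`. -/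
structure IsSolutionOn {m : ℕ}
    (f : ℝ → EuclideanSpace ℝ (Fin m) → EuclideanSpace ℝ (Fin m))
    (Ωt : Set ℝ) (Ωh : Set (EuclideanSpace ℝ (Fin m))) (a : EuclideanSpace ℝ (Fin m))
    (J : Set ℝ) (h : ℝ → EuclideanSpace ℝ (Fin m)) : Prop where
  isOpen : IsOpen J
  ordConnected : J.OrdConnected
  zero_mem : 0 ∈ J
  subset : J ⊆ Ωt
  initial : h 0 = a
  mem : ∀ t ∈ J, h t ∈ Ωh
  hasDerivAt : ∀ t ∈ J, HasDerivAt h (f t (h t)) t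

/-- The maximal time interval of existence `I_a` of the initial value problem `h' = f(t, h)`,
`h 0 = a`: the union of all open intervals around `0` on which a solution exists. -/
def maximalInterval {m : ℕ}
    (f : ℝ → EuclideanSpace ℝ (Fin m) → EuclideanSpace ℝ (Fin m))
    (Ωt : Set ℝ) (Ωh : Set (EuclideanSpace ℝ (Fin m))) (a : EuclideanSpace ℝ (Fin m)) : Set ℝ :=
  {t | ∃ J h, IsSolutionOn f Ωt Ωh a J h ∧ t ∈ J}

open Classical in
/-- The value `h_a(t)` of the solution with initial value `a`, for `t` in its maximal interval
of existence (and `0` for other `t`). -/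
noncomputable def solution {m : ℕ}
    (f : ℝ → EuclideanSpace ℝ (Fin m) → EuclideanSpace ℝ (Fin m))
    (Ωt : Set ℝ) (Ωh : Set (EuclideanSpace ℝ (Fin m))) (a : EuclideanSpace ℝ (Fin m))
    (t : ℝ) : EuclideanSpace ℝ (Fin m) :=
  if ht : t ∈ maximalInterval f Ωt Ωh a then ht.choose_spec.choose t else 0

/-- A scalar neural ODE architecture in `NODE^k(X, ℝ)`, with input set `X ⊆ ℝ^n` and phase space
dimension `m`. -/
structure NeuralODE (k : ℕ∞) (n m : ℕ) (X : Set (EuclideanSpace ℝ (Fin n))) where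
  /-- the vector field -/
  f : ℝ → EuclideanSpace ℝ (Fin m) → EuclideanSpace ℝ (Fin m)
  /-- the time domain of the vector field -/
  Ωt : Set ℝ
  /-- the space domain of the vector field -/
  Ωh : Set (EuclideanSpace ℝ (Fin m))
  /-- the final time -/
  T : ℝ
  /-- the weight matrix of the inner affine layer -/
  W : Matrix (Fin m) (Fin n) ℝ
  /-- the bias of the inner affine layer -/
  b : EuclideanSpace ℝ (Fin m)
  /-- the weight matrix (a row vector) of the outer affine layer -/
  Wout : Matrix (Fin 1) (Fin m) ℝ
  /-- the bias of the outer affine layer -/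
  bout : ℝ
  isOpen_X : IsOpen X
  isOpen_Ωt : IsOpen Ωt
  isOpen_Ωh : IsOpen Ωh
  T_nonneg : 0 ≤ T
  f_regular : IsC0k k f Ωt Ωh
  mem_Ωh : ∀ x ∈ X, W.toEuclideanLin x + b ∈ Ωh
  Icc_subset : ∀ x ∈ X, Set.Icc 0 T ⊆ maximalInterval f Ωt Ωh (W.toEuclideanLin x + b)

namespace NeuralODE

variable {k : ℕ∞} {n m : ℕ} {X : Set (EuclideanSpace ℝ (Fin n))}

/-- The inner affine layer `λ(x) = W x + b`. -/
noncomputable def inner (N : NeuralODE k n m X) (x : EuclideanSpace ℝ (Fin n)) :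
    EuclideanSpace ℝ (Fin m) :=
  N.W.toEuclideanLin x + N.b

/-- The map `η(a) = W̃ h_a(T)`, for every initial value `a` whose solution exists on `[0, T]`. -/
noncomputable def eta (N : NeuralODE k n m X) (a : EuclideanSpace ℝ (Fin m)) : ℝ :=
  (N.Wout.toEuclideanLin (solution N.f N.Ωt N.Ωh a N.T)) 0

/-- The input-output map `Φ(x) = W̃ h_{W x + b}(T) + b̃`. -/
noncomputable def toFun (N : NeuralODE k n m X) (x : EuclideanSpace ℝ (Fin n)) : ℝ :=
  N.eta (N.inner x) + N.bout

/-- At least one of the two weight matrices does not have full rank. -/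
def IsDegenerate (N : NeuralODE k n m X) : Prop :=
  N.W.rank < min m n ∨ N.Wout.rank = 0

end NeuralODE

end ScalarNODE

/-! The analytic content is that `η` is `C^k`. On `[α, β]`, with `0` and `T` in its interior, the
initial value problem is the integral equation `P u = const a`, where `P u = u - V (F u)`, `V` is
integration from `0` and `F` is superposition with `f`. `F` is as smooth as `f` is in its second
variable (`contDiffAt_superposition`). The derivative of `P` is the identity minus a Volterra
operator, whose iterates decay factorially, so it is invertible. The inverse function theorem makes
the solution a `C^k` function of `a`, and evaluation at `T` preserves this; uniqueness identifies it
with `solution`.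

The rest is linear algebra. The inner layer is affine, so the chain rule gives the Hessian as `Wᵀ H
W`. This has rank less than `n` when `W` is rank deficient, and it vanishes when `Wout = 0`. So the
Hessian is singular everywhere, in particular at critical points. -/

open Set Filter Topology

/-! ### Superposition operators on spaces of continuous functions -/

section Superposition

universe v w

variable {K : Type w} [TopologicalSpace K] {E F : Type v}
  [NormedAddCommGroup E] [NormedAddCommGroup F]

/-- The superposition (Nemytskii) operator `u ↦ (s ↦ f s (u s))`. -/
noncomputable def superposition (f : K → E → F) (u : C(K, E)) : C(K, F) :=
  ContinuousMap.mkD (fun s => f s (u s)) 0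

/-- `superposition` takes the default value `0` when the composite is not continuous; values of `u`
in `Ω` exclude this. -/
theorem superposition_apply {f : K → E → F} {Ω : Set E}
    (hf : ContinuousOn (fun p : K × E => f p.1 p.2) (univ ×ˢ Ω)) {u : C(K, E)}
    (hu : ∀ s, u s ∈ Ω) (s : K) : superposition f u s = f s (u s) := by
  refine ContinuousMap.mkD_apply_of_continuous ?_
  exact hf.comp_continuous (f := fun s => (s, u s)) (by fun_prop) fun s => ⟨mem_univ _, hu s⟩

section

variable [CompactSpace K]

/-- Compactness of `K` makes continuity uniform in `s`. Constant shifts `y` suffice, as a nearby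
function is a small shift of `u` at each `s` separately. -/
theorem eventually_forall_norm_sub_lt {f : K → E → F} {Ω : Set E} (hΩ : IsOpen Ω)
    (hf : ContinuousOn (fun p : K × E => f p.1 p.2) (univ ×ˢ Ω)) {u : C(K, E)}
    (hu : ∀ s, u s ∈ Ω) {ε : ℝ} (hε : 0 < ε) :
    ∀ᶠ y in 𝓝 (0 : E), ∀ s, u s + y ∈ Ω ∧ ‖f s (u s + y) - f s (u s)‖ < ε := by
  have key := isCompact_univ.eventually_forall_of_forall_eventually (x₀ := (0 : E))
    (K := (univ : Set K)) (P := fun y s => u s + y ∈ Ω ∧ ‖f s (u s + y) - f s (u s)‖ < ε) ?_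
  · simpa using key
  intro s _
  have hc : ∀ p : K × E, p.2 ∈ Ω → ContinuousAt (fun p : K × E => f p.1 p.2) p := fun p hp =>
    hf.continuousAt ((isOpen_univ.prod hΩ).mem_nhds ⟨mem_univ _, hp⟩)
  have h1 : ContinuousAt (fun z : E × K => f z.2 (u z.2 + z.1)) (0, s) :=
    ContinuousAt.comp (f := fun z : E × K => (z.2, u z.2 + z.1))
      (g := fun p : K × E => f p.1 p.2) (hc _ (by simpa using hu s)) (by fun_prop)
  have h2 : ContinuousAt (fun z : E × K => f z.2 (u z.2)) (0, s) :=
    ContinuousAt.comp (f := fun z : E × K => (z.2, u z.2))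
      (g := fun p : K × E => f p.1 p.2) (hc _ (by simpa using hu s)) (by fun_prop)
  have h3 : ContinuousAt (fun z : E × K => u z.2 + z.1) (0, s) := by fun_prop
  have h4 := (h1.sub h2).norm
  refine (h3.eventually (hΩ.mem_nhds (by simpa using hu s))).and
    (h4.eventually (gt_mem_nhds ?_))
  simpa using hε

theorem isOpen_setOf_forall_mem {Ω : Set E} (hΩ : IsOpen Ω) :
    IsOpen {u : C(K, E) | ∀ s, u s ∈ Ω} := by
  simpa [MapsTo] using
    ContinuousMap.isOpen_setOfPred_mapsTo (X := K) (isCompact_univ (X := K)) hΩ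

theorem continuousAt_superposition {f : K → E → F} {Ω : Set E} (hΩ : IsOpen Ω)
    (hf : ContinuousOn (fun p : K × E => f p.1 p.2) (univ ×ˢ Ω)) {u : C(K, E)}
    (hu : ∀ s, u s ∈ Ω) : ContinuousAt (superposition f) u := by
  rw [Metric.continuousAt_iff]
  intro ε hε
  obtain ⟨δ, hδ, h⟩ := Metric.eventually_nhds_iff.1
    (eventually_forall_norm_sub_lt hΩ hf hu (half_pos hε))
  refine ⟨δ, hδ, fun {w} hw => ?_⟩
  have hs : ∀ s, dist (w s - u s) 0 < δ := fun s => by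
    rw [dist_zero_right, ← dist_eq_norm]
    exact (ContinuousMap.dist_apply_le_dist s).trans_lt hw
  have hwΩ : ∀ s, w s ∈ Ω := fun s => by simpa using (h (hs s) s).1
  refine lt_of_le_of_lt ((ContinuousMap.dist_le (half_pos hε).le).2 fun s => ?_) (half_lt_self hε)
  rw [superposition_apply hf hwΩ, superposition_apply hf hu, dist_eq_norm]
  simpa using (h (hs s) s).2.le

end

variable [NormedSpace ℝ E] [NormedSpace ℝ F]

/-- `f` has `n` partial derivatives in its second variable on `Ω`, jointly continuous together
with `f`. -/
def HasContPartials (n : ℕ) (f : K → E → F) (Ω : Set E) : Prop :=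
  (∀ s, ContDiffOn ℝ n (f s) Ω) ∧
    ∀ j ≤ n, ContinuousOn (fun p : K × E => iteratedFDeriv ℝ j (f p.1) p.2) (univ ×ˢ Ω)

theorem HasContPartials.continuousOn {n : ℕ} {f : K → E → F} {Ω : Set E}
    (hf : HasContPartials n f Ω) : ContinuousOn (fun p : K × E => f p.1 p.2) (univ ×ˢ Ω) := by
  have h := (continuousMultilinearCurryFin0 ℝ E F).continuous.comp_continuousOn
    (hf.2 0 (Nat.zero_le _))
  refine h.congr fun p _ => ?_
  simp

theorem HasContPartials.fderiv {n : ℕ} {f : K → E → F} {Ω : Set E} (hΩ : IsOpen Ω)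
    (hf : HasContPartials (n + 1) f Ω) :
    HasContPartials n (fun s => fderiv ℝ (f s)) Ω := by
  refine ⟨fun s => (hf.1 s).fderiv_of_isOpen hΩ (by norm_cast), fun j hj => ?_⟩
  have h := (continuousMultilinearCurryRightEquiv' ℝ j E F).continuous.comp_continuousOn
    (hf.2 (j + 1) (by omega))
  refine h.congr fun p _ => ?_
  simp [iteratedFDeriv_succ_eq_comp_right]

theorem HasContPartials.hasFDerivAt {n : ℕ} {f : K → E → F} {Ω : Set E} (hΩ : IsOpen Ω)
    (hf : HasContPartials (n + 1) f Ω) (s : K) {y : E} (hy : y ∈ Ω) :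
    HasFDerivAt (f s) (_root_.fderiv ℝ (f s) y) y :=
  (((hf.1 s).contDiffAt (hΩ.mem_nhds hy)).differentiableAt (by simp)).hasFDerivAt

theorem HasContPartials.of_le {m n : ℕ} {f : K → E → F} {Ω : Set E}
    (hf : HasContPartials n f Ω) (hmn : m ≤ n) : HasContPartials m f Ω :=
  ⟨fun s => (hf.1 s).of_le (by exact_mod_cast hmn), fun j hj => hf.2 j (hj.trans hmn)⟩

variable [CompactSpace K]

/-- Pointwise application of a continuous family of linear maps. -/
noncomputable def pointwiseApply (K : Type w) [TopologicalSpace K] [CompactSpace K] (E F : Type v)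
    [NormedAddCommGroup E] [NormedSpace ℝ E] [NormedAddCommGroup F] [NormedSpace ℝ F] :
    C(K, E →L[ℝ] F) →L[ℝ] C(K, E) →L[ℝ] C(K, F) :=
  LinearMap.mkContinuous₂
    (LinearMap.mk₂ ℝ (fun (A : C(K, E →L[ℝ] F)) (u : C(K, E)) =>
        (⟨fun s => A s (u s), by fun_prop⟩ : C(K, F)))
      (fun A B u => by ext; simp) (fun c A u => by ext; simp)
      (fun A u v => by ext; simp) (fun c A u => by ext; simp)) 1
    (fun A u => by
      refine (ContinuousMap.norm_le _ (by positivity)).2 fun s => ?_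
      rw [one_mul]
      exact ((A s).le_opNorm _).trans
        (by gcongr; exacts [A.norm_coe_le_norm s, u.norm_coe_le_norm s]))

@[simp]
theorem pointwiseApply_apply (A : C(K, E →L[ℝ] F)) (u : C(K, E)) (s : K) :
    pointwiseApply K E F A u s = A s (u s) := rfl

/-- The mean value inequality on a ball around each `u s`, with a radius independent of `s`, bounds
the remainder uniformly. -/
theorem hasFDerivAt_superposition {f : K → E → F} {Ω : Set E} (hΩ : IsOpen Ω)
    (hf : HasContPartials 1 f Ω) {u : C(K, E)} (hu : ∀ s, u s ∈ Ω) :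
    HasFDerivAt (superposition f)
      (pointwiseApply K E F (superposition (fun s => fderiv ℝ (f s)) u)) u := by
  have hf' : HasContPartials 0 (fun s => fderiv ℝ (f s)) Ω := HasContPartials.fderiv hΩ hf
  rw [hasFDerivAt_iff_isLittleO, Asymptotics.isLittleO_iff]
  intro ε hε
  obtain ⟨δ, hδ, h⟩ := Metric.eventually_nhds_iff.1
    (eventually_forall_norm_sub_lt (f := fun s => fderiv ℝ (f s)) hΩ hf'.continuousOn hu hε)
  filter_upwards [Metric.ball_mem_nhds u hδ] with w hw
  have hs : ∀ s, dist (w s) (u s) < δ := fun s =>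
    (ContinuousMap.dist_apply_le_dist s).trans_lt hw
  have hball : ∀ s, ∀ y ∈ Metric.ball (u s) δ, y ∈ Ω ∧
      ‖fderiv ℝ (f s) y - fderiv ℝ (f s) (u s)‖ < ε := fun s y hy => by
    have := h (y := y - u s) (by rwa [dist_zero_right, ← dist_eq_norm]) s
    simpa using this
  refine (ContinuousMap.norm_le _ (by positivity)).2 fun s => ?_
  have hwΩ : ∀ s, w s ∈ Ω := fun s => (hball s _ (hs s)).1
  have := Convex.norm_image_sub_le_of_norm_hasFDerivWithin_le' (f := f s)
    (f' := fderiv ℝ (f s)) (φ := fderiv ℝ (f s) (u s)) (C := ε) (s := Metric.ball (u s) δ)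
    (x := u s) (y := w s)
    (fun y hy => (hf.hasFDerivAt hΩ s (hball s y hy).1).hasFDerivWithinAt)
    (fun y hy => (hball s y hy).2.le) (convex_ball _ _) (Metric.mem_ball_self hδ) (hs s)
  simp only [ContinuousMap.sub_apply, pointwiseApply_apply,
    superposition_apply hf.continuousOn hwΩ, superposition_apply hf.continuousOn hu,
    superposition_apply (f := fun s => fderiv ℝ (f s)) hf'.continuousOn hu]
  refine this.trans (mul_le_mul_of_nonneg_left ?_ hε.le)
  exact (w - u).norm_coe_le_norm s

/-- The derivative is again a superposition operator, followed by a bounded linear map; hence the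
induction varies `F`. -/
theorem contDiffAt_superposition (n : ℕ) {E F : Type v} [NormedAddCommGroup E] [NormedSpace ℝ E]
    [NormedAddCommGroup F] [NormedSpace ℝ F] {f : K → E → F} {Ω : Set E} (hΩ : IsOpen Ω)
    (hf : HasContPartials n f Ω) {u : C(K, E)} (hu : ∀ s, u s ∈ Ω) :
    ContDiffAt ℝ n (superposition f) u := by
  induction n generalizing F with
  | zero =>
    rw [Nat.cast_zero, contDiffAt_zero]
    exact ⟨_, (isOpen_setOf_forall_mem hΩ).mem_nhds hu, fun w hw =>
      (continuousAt_superposition hΩ hf.continuousOn hw).continuousWithinAt⟩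
  | succ n ih =>
    rw [Nat.cast_succ, contDiffAt_succ_iff_hasFDerivAt]
    exact ⟨fun w => pointwiseApply K E F (superposition (fun s => _root_.fderiv ℝ (f s)) w),
      ⟨_, (isOpen_setOf_forall_mem hΩ).mem_nhds hu, fun w hw =>
        hasFDerivAt_superposition hΩ (hf.of_le (by omega)) hw⟩,
      (pointwiseApply K E F).contDiff.contDiffAt.fun_comp u (ih (hf.fderiv hΩ))⟩

end Superposition

/-! ### Neumann series and Volterra integral equations -/

theorem exists_equiv_id_sub_of_norm_iterate_le {X : Type*} [NormedAddCommGroup X]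
    [NormedSpace ℝ X] [CompleteSpace X] (T : X →L[ℝ] X) {r : ℝ} (hr : 0 ≤ r)
    (hT : ∀ (n : ℕ) (v : X), ‖T^[n] v‖ ≤ r ^ n / n.factorial * ‖v‖) :
    ∃ e : X ≃L[ℝ] X, (e : X →L[ℝ] X) = ContinuousLinearMap.id ℝ X - T := by
  have hbound : ∀ n : ℕ, ‖T ^ n‖ ≤ r ^ n / n.factorial := fun n =>
    ContinuousLinearMap.opNorm_le_bound _ (by positivity) fun v => by
      rw [FunLike.coe_pow_eq_iterate]
      exact hT n v
  have hs : Summable fun n : ℕ => T ^ n :=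
    Summable.of_norm_bounded (Real.summable_pow_div_factorial r) hbound
  obtain ⟨U, hU⟩ : IsUnit (1 - T) :=
    isUnit_iff_exists.2 ⟨_, hs.one_sub_mul_tsum_pow, hs.tsum_pow_mul_one_sub⟩
  exact ⟨ContinuousLinearEquiv.unitsEquiv ℝ X U, hU⟩

section Volterra

variable {α β : ℝ} {E : Type*} [NormedAddCommGroup E] [NormedSpace ℝ E]

/-- The Volterra operator `v ↦ (t ↦ ∫ s in 0..t, v s)` on continuous functions on `[α, β]`. -/
noncomputable def volterra (h : α ≤ β) (E : Type*) [NormedAddCommGroup E] [NormedSpace ℝ E] :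
    C(Icc α β, E) →L[ℝ] C(Icc α β, E) :=
  LinearMap.mkContinuous
    { toFun := fun v => ⟨fun t => ∫ s in (0 : ℝ)..t, v (projIcc α β h s),
        (intervalIntegral.continuous_primitive (fun a b =>
          (v.continuous.comp continuous_projIcc).intervalIntegrable a b) 0).comp
          continuous_subtype_val⟩
      map_add' := fun v w => by
        ext t
        exact intervalIntegral.integral_add
          ((v.continuous.comp continuous_projIcc).intervalIntegrable _ _)
          ((w.continuous.comp continuous_projIcc).intervalIntegrable _ _)
      map_smul' := fun c v => by
        ext t
        exact intervalIntegral.integral_smul c _ }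
    (max |α| |β|) (fun v => by
      refine (ContinuousMap.norm_le _ (by positivity)).2 fun t => ?_
      refine (intervalIntegral.norm_integral_le_of_norm_le_const
        fun s _ => v.norm_coe_le_norm _).trans ?_
      rw [mul_comm, sub_zero]
      exact mul_le_mul_of_nonneg_right (abs_le_max_abs_abs t.2.1 t.2.2) (norm_nonneg _))

theorem volterra_apply (h : α ≤ β) (v : C(Icc α β, E)) (t : Icc α β) :
    volterra h E v t = ∫ s in (0 : ℝ)..t, v (projIcc α β h s) := rfl

/-- Each integration turns `|s|^n / n!` into `|t|^(n+1) / (n+1)!`. The bound on `A` must be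
pointwise in `t` to be used under the integral. -/
theorem norm_volterra_comp_iterate_le (h : α ≤ β) (h0 : (0 : ℝ) ∈ Icc α β)
    {A : C(Icc α β, E) →L[ℝ] C(Icc α β, E)} {M : ℝ} (hM : 0 ≤ M)
    (hA : ∀ v t, ‖A v t‖ ≤ M * ‖v t‖) (n : ℕ) (v : C(Icc α β, E)) (t : Icc α β) :
    ‖((volterra h E ∘L A)^[n]) v t‖ ≤ (M * |(t : ℝ)|) ^ n / n.factorial * ‖v‖ := by
  induction n generalizing t with
  | zero => simpa using v.norm_coe_le_norm t
  | succ n ih =>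
    set w := ((volterra h E ∘L A)^[n]) v with hw
    have e : ((volterra h E ∘L A)^[n + 1]) v = volterra h E (A w) := by
      rw [Function.iterate_succ_apply']; rfl
    rw [e, volterra_apply]
    have hle : ∀ s ∈ uIoc 0 (t : ℝ), ‖A w (projIcc α β h s)‖ ≤
        (M ^ (n + 1) / n.factorial * ‖v‖) * |s - 0| ^ n := fun s hs => by
      have hs' : s ∈ Icc α β := by
        have := uIoc_subset_uIcc hs
        exact (uIcc_subset_Icc h0 t.2) this
      rw [projIcc_of_mem h hs']
      refine (hA _ _).trans ((mul_le_mul_of_nonneg_left (ih _) hM).trans (le_of_eq ?_))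
      simp only [sub_zero]
      ring
    have hi : IntervalIntegrable
        (fun s : ℝ => (M ^ (n + 1) / n.factorial * ‖v‖) * |s - 0| ^ n) MeasureTheory.volume 0 t :=
      Continuous.intervalIntegrable (by fun_prop) _ _
    refine (intervalIntegral.norm_integral_le_integral_norm_uIoc).trans ?_
    refine (MeasureTheory.setIntegral_mono_on ?_ hi.def' measurableSet_uIoc hle).trans
      (le_of_eq ?_)
    · exact (Continuous.intervalIntegrable
        (((A w).continuous.comp continuous_projIcc).norm) _ _).def'
    · rw [MeasureTheory.integral_const_mul, integral_pow_abs_sub_uIoc, Nat.factorial_succ]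
      have : (n.factorial : ℝ) ≠ 0 := by positivity
      push_cast
      rw [sub_zero]
      field_simp
      ring

theorem exists_equiv_id_sub_volterra_comp [CompleteSpace E] (h : α ≤ β) (h0 : (0 : ℝ) ∈ Icc α β)
    {A : C(Icc α β, E) →L[ℝ] C(Icc α β, E)} {M : ℝ} (hM : 0 ≤ M)
    (hA : ∀ v t, ‖A v t‖ ≤ M * ‖v t‖) : 
    ∃ e : C(Icc α β, E) ≃L[ℝ] C(Icc α β, E), (e : C(Icc α β, E) →L[ℝ] C(Icc α β, E)) =
      ContinuousLinearMap.id ℝ _ - volterra h E ∘L A := by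
  refine exists_equiv_id_sub_of_norm_iterate_le _ (r := M * max |α| |β|) (by positivity)
    fun n v => (ContinuousMap.norm_le _ (by positivity)).2 fun t => ?_
  refine (norm_volterra_comp_iterate_le h h0 hM hA n v t).trans ?_
  have : |(t : ℝ)| ≤ max |α| |β| := abs_le_max_abs_abs t.2.1 t.2.2
  gcongr

/-- Smooth dependence on the initial value, for the integral equation
`u t = a + ∫ s in 0..t, f s (u s)` on `[α, β]`. -/
theorem exists_contDiffAt_integral_solution [CompleteSpace E] (h : α ≤ β)
    (h0 : (0 : ℝ) ∈ Icc α β) {n : ℕ} (hn : n ≠ 0) {f : Icc α β → E → E} {Ω : Set E}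
    (hΩ : IsOpen Ω) (hf : HasContPartials n f Ω) {u₀ : C(Icc α β, E)} (hu₀ : ∀ s, u₀ s ∈ Ω)
    {a₀ : E} (hsol : u₀ = ContinuousMap.const _ a₀ + volterra h E (superposition f u₀)) :
    ∃ g : E → C(Icc α β, E), ContDiffAt ℝ n g a₀ ∧ ∀ᶠ a in 𝓝 a₀, (∀ s, g a s ∈ Ω) ∧
      g a = ContinuousMap.const _ a + volterra h E (superposition f (g a)) := by
  set P : C(Icc α β, E) → C(Icc α β, E) := fun u => u - volterra h E (superposition f u) with hP
  have hPC : ContDiffAt ℝ n P u₀ :=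
    contDiffAt_id.sub
      ((volterra h E).contDiff.contDiffAt.fun_comp u₀ (contDiffAt_superposition n hΩ hf hu₀))
  set B := superposition (fun s => fderiv ℝ (f s)) u₀
  set A := pointwiseApply (Icc α β) E E B with hA
  have hAle : ∀ v t, ‖A v t‖ ≤ ‖B‖ * ‖v t‖ := fun v t =>
    ((B t).le_opNorm _).trans (by gcongr; exact B.norm_coe_le_norm t)
  obtain ⟨e, he⟩ := exists_equiv_id_sub_volterra_comp h h0 (norm_nonneg _) hAle
  have hPd : HasFDerivAt P (e : C(Icc α β, E) →L[ℝ] C(Icc α β, E)) u₀ := by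
    have h1 := (hasFDerivAt_id (𝕜 := ℝ) u₀).sub
      ((volterra h E).hasFDerivAt.comp u₀
        (hasFDerivAt_superposition hΩ (hf.of_le (by omega)) hu₀))
    rw [he]
    exact h1
  have hn' : (n : WithTop ℕ∞) ≠ 0 := by exact_mod_cast hn
  have hPu : P u₀ = ContinuousMap.const _ a₀ := sub_eq_of_eq_add hsol
  set ψ := hPC.localInverse hPd hn' with hψ
  have hψC : ContDiffAt ℝ n ψ (ContinuousMap.const _ a₀) := hPu ▸ hPC.to_localInverse hPd hn'
  have hψ₀ : ψ (ContinuousMap.const _ a₀) = u₀ := hPu ▸ hPC.localInverse_apply_image hPd hn'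
  have hright : ∀ᶠ c in 𝓝 (ContinuousMap.const (Icc α β) a₀), P (ψ c) = c := by
    rw [← hPu]
    exact (hPC.hasStrictFDerivAt' hPd hn').eventually_right_inverse
  have hc : ContDiff ℝ n (fun a : E => ContinuousMap.const (Icc α β) a) :=
    (ContinuousLinearMap.const ℝ (M := E) (Icc α β)).contDiff
  have hct : Tendsto (fun a : E => ContinuousMap.const (Icc α β) a) (𝓝 a₀)
    (𝓝 (ContinuousMap.const _ a₀)) := hc.continuous.continuousAt
  refine ⟨fun a => ψ (ContinuousMap.const _ a), hψC.fun_comp a₀ hc.contDiffAt, ?_⟩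
  have hmem : ∀ᶠ c in 𝓝 (ContinuousMap.const (Icc α β) a₀), ∀ s, ψ c s ∈ Ω :=
    -- Taking values in `Ω` is an open condition, and the local inverse is continuous.
    hψC.continuousAt.eventually (p := fun u => ∀ s, u s ∈ Ω)
      (hψ₀.symm ▸ (isOpen_setOf_forall_mem hΩ).mem_nhds hu₀)
  filter_upwards [hct.eventually hright, hct.eventually hmem] with a h1 h2
  exact ⟨h2, sub_eq_iff_eq_add.1 h1⟩

end Volterra

/-! ### Uniqueness of solutions and smooth dependence on the initial value -/

namespace ScalarNODE

variable {m : ℕ} {k : ℕ∞} {f : ℝ → EuclideanSpace ℝ (Fin m) → EuclideanSpace ℝ (Fin m)}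
  {Ωt : Set ℝ} {Ωh : Set (EuclideanSpace ℝ (Fin m))} {a : EuclideanSpace ℝ (Fin m)}

theorem IsC0k.hasContPartials (hf : IsC0k k f Ωt Ωh) {S : Set ℝ} (hS : S ⊆ Ωt) {n : ℕ}
    (hn : (n : ℕ∞) ≤ k) : HasContPartials n (fun s : S => f s) Ωh := by
  refine ⟨fun s => (hf.1 s (hS s.2)).of_le (by exact_mod_cast hn), fun j hj => ?_⟩
  have hjk : (j : ℕ∞) ≤ k := le_trans (by exact_mod_cast hj) hn
  exact (hf.2 j hjk).comp (f := fun p : S × EuclideanSpace ℝ (Fin m) => ((p.1 : ℝ), p.2))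
    (by fun_prop) fun p hp => ⟨hS p.1.2, hp.2⟩

/-- Joint continuity bounds the space derivative near `(t, y)`; on a convex ball this bound is a
Lipschitz constant. -/
theorem IsC0k.exists_lipschitzOnWith (hf : IsC0k k f Ωt Ωh) (hk : 1 ≤ k) (hΩt : IsOpen Ωt)
    (hΩh : IsOpen Ωh) {t : ℝ} (ht : t ∈ Ωt) {y : EuclideanSpace ℝ (Fin m)} (hy : y ∈ Ωh) :
    ∃ C : NNReal, ∃ s ∈ 𝓝 y, ∀ᶠ t' in 𝓝 t, LipschitzOnWith C (f t') s := by
  have hp := hf.hasContPartials (S := Ωt) subset_rfl (n := 1) (by simpa using hk)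
  have hp' : HasContPartials 0 (fun s : Ωt => fderiv ℝ (f s)) Ωh := HasContPartials.fderiv hΩh hp
  have hc : ContinuousAt (fun p : Ωt × EuclideanSpace ℝ (Fin m) => ‖fderiv ℝ (f p.1) p.2‖₊)
      (⟨t, ht⟩, y) :=
    (hp'.continuousOn.continuousAt
      ((isOpen_univ.prod hΩh).mem_nhds ⟨mem_univ _, hy⟩)).nnnorm
  have hev := (hc.eventually (gt_mem_nhds (lt_add_one _))).and
    ((isOpen_univ.prod hΩh).mem_nhds
      (show ((⟨t, ht⟩ : Ωt), y) ∈ (univ : Set Ωt) ×ˢ Ωh from ⟨mem_univ _, hy⟩))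
  rw [nhds_prod_eq] at hev
  obtain ⟨p, hpt, q, hqy, hpq⟩ := eventually_prod_iff.1 hev
  obtain ⟨δ, hδ, hball⟩ := Metric.eventually_nhds_iff_ball.1 hqy
  refine ⟨‖fderiv ℝ (f t) y‖₊ + 1, Metric.ball y δ, Metric.ball_mem_nhds y hδ, ?_⟩
  have hpt' : ∀ᶠ t' in 𝓝 t, ∀ h : t' ∈ Ωt, p ⟨t', h⟩ := by
    rw [nhds_subtype_eq_comap, eventually_comap] at hpt
    filter_upwards [hpt] with t' h h' using h ⟨t', h'⟩ rfl
  filter_upwards [hpt', hΩt.mem_nhds ht] with t' h1 h2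
  refine (convex_ball y δ).lipschitzOnWith_of_nnnorm_fderiv_le (𝕜 := ℝ) (fun z hz => ?_)
    fun z hz => ?_
  · exact (hp.hasFDerivAt hΩh ⟨t', h2⟩ (hpq (h1 h2) (hball z hz)).2.2).differentiableAt
  · exact (hpq (h1 h2) (hball z hz)).1.le

/-- The times near which both solutions agree form an open set, relatively closed in the connected
`J₁ ∩ J₂` by continuity and local uniqueness. -/
theorem IsSolutionOn.eq (hf : IsC0k k f Ωt Ωh) (hk : 1 ≤ k) (hΩt : IsOpen Ωt)
    (hΩh : IsOpen Ωh) {J₁ J₂ : Set ℝ} {h₁ h₂ : ℝ → EuclideanSpace ℝ (Fin m)}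
    (H₁ : IsSolutionOn f Ωt Ωh a J₁ h₁) (H₂ : IsSolutionOn f Ωt Ωh a J₂ h₂) {t : ℝ}
    (ht₁ : t ∈ J₁) (ht₂ : t ∈ J₂) : h₁ t = h₂ t := by
  have hord : (J₁ ∩ J₂).OrdConnected := H₁.ordConnected.inter H₂.ordConnected
  have hlocal : ∀ s ∈ J₁ ∩ J₂, h₁ s = h₂ s → h₁ =ᶠ[𝓝 s] h₂ := fun s hs heq => by
    obtain ⟨C, V, hV, hL⟩ :=
      hf.exists_lipschitzOnWith hk hΩt hΩh (H₁.subset hs.1) (H₁.mem s hs.1)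
    refine ODE_solution_unique_of_eventually (s := fun _ => V) hL ?_ ?_ heq
    · filter_upwards [H₁.isOpen.mem_nhds hs.1,
        (H₁.hasDerivAt s hs.1).continuousAt.eventually_mem hV] with r hr hr'
      exact ⟨H₁.hasDerivAt r hr, hr'⟩
    · rw [heq] at hV
      filter_upwards [H₂.isOpen.mem_nhds hs.2,
        (H₂.hasDerivAt s hs.2).continuousAt.eventually_mem hV] with r hr hr'
      exact ⟨H₂.hasDerivAt r hr, hr'⟩
  have hsub := hord.isPreconnected.subset_of_closure_inter_subset
    (u := {s | h₁ =ᶠ[𝓝 s] h₂}) isOpen_setOfPred_eventually_nhds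
    ⟨0, ⟨H₁.zero_mem, H₂.zero_mem⟩,
      hlocal 0 ⟨H₁.zero_mem, H₂.zero_mem⟩ (H₁.initial.trans H₂.initial.symm)⟩
    (fun s hs => hlocal s hs.2 (tendsto_nhds_unique_of_frequently_eq
      (H₁.hasDerivAt s hs.2.1).continuousAt (H₂.hasDerivAt s hs.2.2).continuousAt
      ((mem_closure_iff_frequently.1 hs.1).mono fun r hr => hr.self_of_nhds)))
  exact (hsub ⟨ht₁, ht₂⟩).self_of_nhds

/-- `solution` chooses a solution anew for each `t`; uniqueness makes the choice immaterial. -/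
theorem IsSolutionOn.solution_eq (hf : IsC0k k f Ωt Ωh) (hk : 1 ≤ k) (hΩt : IsOpen Ωt)
    (hΩh : IsOpen Ωh) {J : Set ℝ} {h : ℝ → EuclideanSpace ℝ (Fin m)}
    (H : IsSolutionOn f Ωt Ωh a J h) {t : ℝ} (ht : t ∈ J) : solution f Ωt Ωh a t = h t := by
  have hmem : t ∈ maximalInterval f Ωt Ωh a := ⟨J, h, H, ht⟩
  rw [solution, dif_pos hmem]
  exact IsSolutionOn.eq hf hk hΩt hΩh hmem.choose_spec.choose_spec.1 H
    hmem.choose_spec.choose_spec.2 ht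

theorem IsSolutionOn.eq_const_add_volterra {α β : ℝ} (h : α ≤ β) (h0 : (0 : ℝ) ∈ Icc α β)
    {J : Set ℝ} {y : ℝ → EuclideanSpace ℝ (Fin m)} (H : IsSolutionOn f Ωt Ωh a J y)
    (hJ : Icc α β ⊆ J) (hf : HasContPartials 0 (fun s : Icc α β => f s) Ωh)
    {u : C(Icc α β, EuclideanSpace ℝ (Fin m))} (hu : ∀ s, u s = y s) :
    u = ContinuousMap.const _ a + volterra h _ (superposition (fun s : Icc α β => f s) u) := by
  ext1 t
  have huΩ : ∀ s, u s ∈ Ωh := fun s => hu s ▸ H.mem s (hJ s.2)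
  have hc : Continuous fun s : ℝ =>
      superposition (fun s : Icc α β => f s) u (projIcc α β h s) :=
    (ContinuousMap.continuous _).comp continuous_projIcc
  rw [ContinuousMap.add_apply, volterra_apply, intervalIntegral.integral_eq_sub_of_hasDerivAt
    (f := y) (fun s hs => ?_) (hc.intervalIntegrable _ _)]
  · simp [hu, H.initial]
  · have hs' : s ∈ Icc α β := uIcc_subset_Icc h0 t.2 hs
    rw [projIcc_of_mem h hs', superposition_apply hf.continuousOn huΩ, hu]
    exact H.hasDerivAt s (hJ hs')

theorem isSolutionOn_of_eq_const_add_volterra {α β : ℝ} (h : α ≤ β) (hα : α < 0) (hβ : 0 < β)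
    (hsub : Icc α β ⊆ Ωt) (hf : HasContPartials 0 (fun s : Icc α β => f s) Ωh)
    {u : C(Icc α β, EuclideanSpace ℝ (Fin m))} (huΩ : ∀ s, u s ∈ Ωh)
    (hu : u = ContinuousMap.const _ a + volterra h _ (superposition (fun s : Icc α β => f s) u)) :
    IsSolutionOn f Ωt Ωh a (Ioo α β) (fun t => u (projIcc α β h t)) := by
  have heq : ∀ t ∈ Icc α β, u (projIcc α β h t) =
      a + ∫ s in (0 : ℝ)..t, superposition (fun s : Icc α β => f s) u (projIcc α β h s) :=
    fun t ht => by
      rw [projIcc_of_mem h ht]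
      exact DFunLike.congr_fun hu ⟨t, ht⟩
  refine ⟨isOpen_Ioo, ordConnected_Ioo, ⟨hα, hβ⟩, Ioo_subset_Icc_self.trans hsub, ?_,
    fun t _ => huΩ _, fun t ht => ?_⟩
  · rw [heq 0 ⟨hα.le, hβ.le⟩]
    simp
  · have hc : Continuous fun s : ℝ =>
        superposition (fun s : Icc α β => f s) u (projIcc α β h s) :=
      (ContinuousMap.continuous _).comp continuous_projIcc
    have hd := (intervalIntegral.integral_hasDerivAt_right (hc.intervalIntegrable 0 t)
      (hc.stronglyMeasurableAtFilter _ _) hc.continuousAt).const_add a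
    have ht' : t ∈ Icc α β := Ioo_subset_Icc_self ht
    rw [superposition_apply hf.continuousOn huΩ] at hd
    have hd' := hd.congr_of_eventuallyEq
      (f₁ := fun t => u (projIcc α β h t)) (by
        filter_upwards [isOpen_Ioo.mem_nhds ht] with s hs using heq s (Ioo_subset_Icc_self hs))
    rwa [projIcc_of_mem h ht'] at hd' ⊢

theorem IsSolutionOn.exists_Icc_subset {J : Set ℝ} {y : ℝ → EuclideanSpace ℝ (Fin m)}
    (H : IsSolutionOn f Ωt Ωh a J y) {T : ℝ} (hT : T ∈ J) :
    ∃ α < 0, ∃ β > T, Icc α β ⊆ J := by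
  obtain ⟨l, hl, hlJ⟩ := exists_Ioc_subset_of_mem_nhds (H.isOpen.mem_nhds H.zero_mem)
    (exists_lt 0)
  obtain ⟨r, hr, hrJ⟩ := exists_Ico_subset_of_mem_nhds (H.isOpen.mem_nhds hT) (exists_gt T)
  obtain ⟨α, hlα, hα⟩ := exists_between hl
  obtain ⟨β, hTβ, hβ⟩ := exists_between hr
  exact ⟨α, hα, β, hTβ, H.ordConnected.out (hlJ ⟨hlα, hα.le⟩) (hrJ ⟨hTβ.le, hβ⟩)⟩

theorem contDiffAt_nat_solution (hf : IsC0k k f Ωt Ωh) (hΩt : IsOpen Ωt)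
    (hΩh : IsOpen Ωh) {T : ℝ} (hT : 0 ≤ T) (hmem : T ∈ maximalInterval f Ωt Ωh a) {n : ℕ}
    (hn : n ≠ 0) (hnk : (n : ℕ∞) ≤ k) :
    ContDiffAt ℝ n (fun a => solution f Ωt Ωh a T) a := by
  have hk : 1 ≤ k := le_trans (by exact_mod_cast Nat.one_le_iff_ne_zero.2 hn) hnk
  obtain ⟨J, y, H, hTJ⟩ := hmem
  obtain ⟨α, hα, β, hβ, hJ⟩ := H.exists_Icc_subset hTJ
  have hβ0 : 0 < β := hT.trans_lt hβ
  have h : α ≤ β := (hα.trans hβ0).le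
  have h0 : (0 : ℝ) ∈ Icc α β := ⟨hα.le, hβ0.le⟩
  have hfn := hf.hasContPartials (hJ.trans H.subset) hnk
  let u₀ : C(Icc α β, EuclideanSpace ℝ (Fin m)) := ⟨fun s => y s, by
    have : ContinuousOn y (Icc α β) := fun s hs =>
      (H.hasDerivAt s (hJ hs)).continuousAt.continuousWithinAt
    exact this.domRestrict⟩
  obtain ⟨g, hg, hev⟩ := exists_contDiffAt_integral_solution h h0 hn hΩh hfn (u₀ := u₀)
    (fun s => H.mem s (hJ s.2))
    (H.eq_const_add_volterra h h0 hJ (hfn.of_le (Nat.zero_le _)) fun _ => rfl)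
  have hTI : T ∈ Ioo α β := ⟨hα.trans_le hT, hβ⟩
  have hval : ContDiffAt ℝ n (fun a => g a ⟨T, Ioo_subset_Icc_self hTI⟩) a :=
    (ContinuousMap.evalCLM ℝ (M := EuclideanSpace ℝ (Fin m))
      (⟨T, Ioo_subset_Icc_self hTI⟩ : Icc α β)).contDiff.contDiffAt.fun_comp a hg
  refine hval.congr_of_eventuallyEq ?_
  filter_upwards [hev] with c hc
  have Hc := isSolutionOn_of_eq_const_add_volterra h hα hβ0 (hJ.trans H.subset)
    (hfn.of_le (Nat.zero_le _)) hc.1 hc.2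
  rw [Hc.solution_eq hf hk hΩt hΩh hTI, projIcc_of_mem h (Ioo_subset_Icc_self hTI)]

theorem contDiffAt_solution (hf : IsC0k k f Ωt Ωh) (hk : 1 ≤ k) (hΩt : IsOpen Ωt)
    (hΩh : IsOpen Ωh) {T : ℝ} (hT : 0 ≤ T) (hmem : T ∈ maximalInterval f Ωt Ωh a) :
    ContDiffAt ℝ k (fun a => solution f Ωt Ωh a T) a := by
  cases k with
  | top =>
    -- The finite-order lemma excludes order `0`, so order `n + 1` is used.
    refine contDiffAt_infty.2 fun n => ?_
    exact (contDiffAt_nat_solution hf hΩt hΩh hT hmem (Nat.succ_ne_zero n) le_top).of_le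
      (by exact_mod_cast Nat.le_succ n)
  | coe n =>
    exact contDiffAt_nat_solution hf hΩt hΩh hT hmem
      (Nat.one_le_iff_ne_zero.1 (by exact_mod_cast hk)) le_rfl

end ScalarNODE

/-! ### Hessians under affine maps, and rank -/

namespace ScalarNODE

open Matrix

theorem fderiv_fderiv_apply_const {E : Type*} [NormedAddCommGroup E] [NormedSpace ℝ E]
    {η : E → ℝ} {z : E} (hη : ContDiffAt ℝ 2 η z) (v w : E) :
    fderiv ℝ (fun y => fderiv ℝ η y v) z w = fderiv ℝ (fderiv ℝ η) z w v := by
  have hd : DifferentiableAt ℝ (fderiv ℝ η) z :=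
    (hη.fderiv_right (m := 1) (by norm_num)).differentiableAt (by simp)
  rw [fderiv_clm_apply hd (by fun_prop)]
  simp

/-- An affine map has constant derivative, so the chain rule leaves no term in the gradient of `η`.
-/
theorem hessian_comp_affine {n m : ℕ} {η : EuclideanSpace ℝ (Fin m) → ℝ}
    (W : Matrix (Fin m) (Fin n) ℝ) (b : EuclideanSpace ℝ (Fin m)) (c : ℝ)
    {x : EuclideanSpace ℝ (Fin n)} (hη : ContDiffAt ℝ 2 η (W.toEuclideanLin x + b)) :
    hessian (fun x => η (W.toEuclideanLin x + b) + c) x =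
      Wᵀ * hessian η (W.toEuclideanLin x + b) * W := by
  set L : EuclideanSpace ℝ (Fin n) →L[ℝ] EuclideanSpace ℝ (Fin m) :=
    LinearMap.toContinuousLinearMap W.toEuclideanLin with hL
  have hA : ∀ y, HasFDerivAt (fun x => W.toEuclideanLin x + b) L y := fun y =>
    L.hasFDerivAt.add_const b
  have hcont : ContinuousAt (fun x => W.toEuclideanLin x + b) x := (hA x).continuousAt
  have hev : ∀ᶠ y in 𝓝 x, fderiv ℝ (fun x => η (W.toEuclideanLin x + b) + c) y =
      (fderiv ℝ η (W.toEuclideanLin y + b)).comp L := by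
    filter_upwards [hcont.eventually (hη.eventually (by simp))] with y hy
    exact (((hy.differentiableAt (by simp)).hasFDerivAt.comp y (hA y)).add_const c).fderiv
  have hd : DifferentiableAt ℝ (fderiv ℝ η) (W.toEuclideanLin x + b) :=
    (hη.fderiv_right (m := 1) (by norm_num)).differentiableAt (by simp)
  have hsingle : ∀ j : Fin n, L (EuclideanSpace.single j 1) =
      ∑ l, W l j • EuclideanSpace.single l (1 : ℝ) := fun j => by
    ext i
    simp [hL, Matrix.toEuclideanLin, Pi.single_apply]
  ext i j
  have h1 : (fun y => fderiv ℝ (fun x => η (W.toEuclideanLin x + b) + c) y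
      (EuclideanSpace.single j 1)) =ᶠ[𝓝 x] fun y =>
      (fun z => fderiv ℝ η z (L (EuclideanSpace.single j 1))) (W.toEuclideanLin y + b) :=
    hev.mono fun y hy => by simp only [hy]; rfl
  have h2 : DifferentiableAt ℝ (fun z => fderiv ℝ η z (L (EuclideanSpace.single j 1)))
      (W.toEuclideanLin x + b) := hd.clm_apply (by fun_prop)
  have h3 := (h2.hasFDerivAt.comp x (hA x)).fderiv
  simp only [hessian, Matrix.of_apply, Matrix.mul_apply, Matrix.transpose_apply]
  rw [h1.fderiv_eq]
  erw [h3]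
  rw [ContinuousLinearMap.comp_apply, fderiv_fderiv_apply_const hη, hsingle, hsingle]
  simp only [fderiv_fderiv_apply_const hη, map_sum, map_smul, _root_.sum_apply,
    _root_.smul_apply, smul_eq_mul, Finset.mul_sum, Finset.sum_mul]
  refine Finset.sum_congr rfl fun _ _ => Finset.sum_congr rfl fun _ _ => by ring

theorem det_eq_zero_of_rank_lt {n : ℕ} {A : Matrix (Fin n) (Fin n) ℝ} (hA : A.rank < n) :
    A.det = 0 := by
  by_contra h
  have := Matrix.rank_of_isUnit A ((Matrix.isUnit_iff_isUnit_det A).2 (isUnit_iff_ne_zero.2 h))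
  simp at this
  omega

theorem eq_zero_of_rank_eq_zero {m n : ℕ} {A : Matrix (Fin m) (Fin n) ℝ} (hA : A.rank = 0) :
    A = 0 := by
  have h : A.mulVecLin = 0 := LinearMap.range_eq_bot.1 (Submodule.finrank_eq_zero.1 hA)
  ext i j
  simpa using congr_fun (LinearMap.congr_fun h (Pi.single j 1)) i

theorem hessian_zero {n : ℕ} (x : EuclideanSpace ℝ (Fin n)) : hessian (fun _ => 0) x = 0 := by
  ext i j
  simp [hessian]

end ScalarNODE

theorem mainTheorem6 {k : ℕ∞} (hk : 2 ≤ k) {n m : ℕ} (hn : 1 ≤ n)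
    {X : Set (EuclideanSpace ℝ (Fin n))} (N : ScalarNODE.NeuralODE k n m X) :
    (∀ x ∈ X, ContDiffAt ℝ k N.eta (N.inner x) ∧
      ScalarNODE.hessian N.toFun x =
        N.W.transpose * ScalarNODE.hessian N.eta (N.inner x) * N.W) ∧
    (N.IsDegenerate →
      (N.W.rank < min m n ∨ N.Wout = 0) ∧
      (∀ p ∈ X, ScalarNODE.IsCriticalPoint N.toFun p →
        ScalarNODE.IsDegenerateCriticalPoint N.toFun p) ∧
      (N.toFun ∈ ScalarNODE.ClassC1 k X ∨ N.toFun ∈ ScalarNODE.ClassC3 k X)) := by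
  have hC : ∀ x ∈ X, ContDiffAt ℝ k N.eta (N.inner x) := fun x hx => by
    have hs := ScalarNODE.contDiffAt_solution N.f_regular (le_trans (by norm_num) hk) N.isOpen_Ωt
      N.isOpen_Ωh N.T_nonneg (N.Icc_subset x hx ⟨N.T_nonneg, le_rfl⟩)
    exact ((EuclideanSpace.proj (0 : Fin 1)).comp
      (LinearMap.toContinuousLinearMap N.Wout.toEuclideanLin)).contDiff.contDiffAt.fun_comp
        (𝕜 := ℝ) _ hs
  have hH : ∀ x ∈ X, ScalarNODE.hessian N.toFun x =
      N.W.transpose * ScalarNODE.hessian N.eta (N.inner x) * N.W := fun x hx =>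
    ScalarNODE.hessian_comp_affine N.W N.b N.bout ((hC x hx).of_le
      (show ((2 : ℕ∞) : WithTop ℕ∞) ≤ k from WithTop.coe_le_coe.2 hk))
  refine ⟨fun x hx => ⟨hC x hx, hH x hx⟩, fun hdeg => ?_⟩
  have hdeg' : N.W.rank < min m n ∨ N.Wout = 0 := 
    hdeg.imp_right ScalarNODE.eq_zero_of_rank_eq_zero
  -- Criticality of `p` plays no role in the singularity of the Hessian.
  have hdet : ∀ p ∈ X, (ScalarNODE.hessian N.toFun p).det = 0 := fun p hp => by
    rw [hH p hp]
    rcases hdeg' with h | h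
    · exact ScalarNODE.det_eq_zero_of_rank_lt
        ((Matrix.rank_mul_le_right _ _).trans_lt (h.trans_le (min_le_right _ _)))
    · have he : N.eta = fun _ => 0 := by
        funext a
        simp [ScalarNODE.NeuralODE.eta, h]
      -- The empty matrix has determinant `1`, so `1 ≤ n` is needed.
      have : Nonempty (Fin n) := ⟨⟨0, hn⟩⟩
      simp [he, ScalarNODE.hessian_zero]
  have hΦ : ContDiffOn ℝ k N.toFun X := fun x hx => by
    have hA : ContDiff ℝ k N.inner :=
      (LinearMap.toContinuousLinearMap N.W.toEuclideanLin).contDiff.add contDiff_const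
    exact (((hC x hx).comp x hA.contDiffAt).add contDiffAt_const).contDiffWithinAt
  refine ⟨hdeg', fun p hp hcrit => ⟨hcrit, hdet p hp⟩, ?_⟩
  by_cases h : ∃ p ∈ X, gradient N.toFun p = 0
  · obtain ⟨p, hp, hcrit⟩ := h
    exact Or.inr ⟨hΦ, p, hp, hcrit, hdet p hp⟩
  · push Not at h
    exact Or.inl ⟨hΦ, h⟩
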